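/- All graphs are finite and simple. For a connected graph $G$ let $d_G(u,v)$ be the length of a shortest path between $u$ and $v$, let $D(G)=(d_G(u,v))_{u,v\in V(G)}$, and let $Tr(G)$ be the diagonal matrix whose entry at $v$ is $\sum_{u\in V(G)}d_G(u,v)$. The distance signless Laplacian spectral radius $\rho_Q(G)$ is the largest eigenvalue of $Q_D(G)=Tr(G)+D(G)$. A pendant vertex is a vertex of degree $1$. For $n\ge 4$ let $T(n,3;1,2)$ be the tree obtained from a path on $n-3$ vertices by attaching one pendant edge at one end of the path and two pendant edges at the other end (for $n=4$ the path is a single vertex, which is both ends, and $T(4,3;1,2)=K_{1,3}$). **Theorem 3.6.** Let $n\ge 4$, and let $G$ be a connected graph of order $n$ with exactly $3$ pendant vertices such that $\rho_Q(H)\le\rho_Q(G)$ for every connected graph $H$ of order $n$ with exactly $3$ pendant vertices. Then $G\cong T(n,3;1,2)$. -/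

import Mathlib

/-- The transmission of the vertex `v`: the sum of its distances to all other vertices. -/
noncomputable def transmission {V : Type*} [Fintype V] (G : SimpleGraph V) (v : V) : ℝ :=
  ∑ u, (G.dist v u : ℝ)

/-- The distance matrix of a graph. -/
noncomputable def distanceMatrix {V : Type*} (G : SimpleGraph V) : Matrix V V ℝ :=
  Matrix.of fun u v => (G.dist u v : ℝ)

/-- The distance signless Laplacian matrix: the diagonal matrix of transmissions plus the
distance matrix. -/
noncomputable def distSignlessLaplacian {V : Type*} [Fintype V] [DecidableEq V]
    (G : SimpleGraph V) : Matrix V V ℝ :=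
  Matrix.diagonal (transmission G) + distanceMatrix G

/-- The largest eigenvalue of the distance signless Laplacian matrix. The matrix is real symmetric,
so on a nonempty vertex set its set of eigenvalues is finite and nonempty and the supremum is
attained. -/
noncomputable def distSignlessLaplacianSpectralRadius {V : Type*} [Fintype V] [DecidableEq V]
    (G : SimpleGraph V) : ℝ :=
  sSup {μ : ℝ | Module.End.HasEigenvalue (Matrix.toLin' (distSignlessLaplacian G)) μ}

open Classical in
/-- The pendant vertices of a graph: the vertices of degree one. -/
noncomputable def pendantVertices {V : Type*} [Fintype V] (G : SimpleGraph V) : Finset V :=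
  {v | G.degree v = 1}

/-- The connected graphs of order `n` with exactly `k` pendant vertices (every graph of order `n`
is isomorphic to one on `Fin n`). -/
def connectedGraphsWithPendants (n k : ℕ) : Set (SimpleGraph (Fin n)) :=
  {G | G.Connected ∧ (pendantVertices G).card = k}

/-- The graph obtained from the path `0, 1, …, ℓ - 1` of order `ℓ` by attaching `t₁` pendant edges
at its end `0` and `t₂` pendant edges at its end `ℓ - 1`. With `k = t₁ + t₂` and `n = ℓ + k` this is
the tree `T(n, k; t₁, t₂)`. -/
def pathWithPendantEdges (ℓ t₁ t₂ : ℕ) : SimpleGraph (Fin ℓ ⊕ (Fin t₁ ⊕ Fin t₂)) where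
  Adj
    | .inl i, .inl j => (SimpleGraph.pathGraph ℓ).Adj i j
    | .inl i, .inr (.inl _) => (i : ℕ) = 0
    | .inr (.inl _), .inl i => (i : ℕ) = 0
    | .inl i, .inr (.inr _) => (i : ℕ) + 1 = ℓ
    | .inr (.inr _), .inl i => (i : ℕ) + 1 = ℓ
    | .inr _, .inr _ => False
  symm := ⟨by
    rintro (i | a | b) (j | c | d) h <;> first | exact h | exact SimpleGraph.Adj.symm h⟩
  loopless := ⟨by rintro (i | a | b) h <;> first | exact h | exact SimpleGraph.irrefl _ h⟩

/-! The spectral radius is governed by the form `∑ d(u,v) (x u + x v)²`. At the positive Perron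
vector `x` of `G`, any graph with a larger form has a larger radius, so it suffices to lengthen
distances.

The extremal problem is relaxed to at least three pendant vertices, a class closed under passing to
spanning trees, so a maximizer is a tree (`isTree`). At a vertex `u` with neighbours `a`, `b`, `c`,
the branch through `c` can be moved to `a` or to `b`. At most one of `a`, `b` is closer than `u` to
a given vertex, so the two new distances average at least the old one
(`two_mul_dist_le_dist_moveBranch_add`), and one of the moves raises the form. Moving to `a` can
destroy only the pendant vertex `a`, so maximality forces exactly three pendant vertices, two of
them adjacent to the unique branching vertex (`exists_isBroom`). Such a broom is the required tree
(`nonempty_iso`). As relaxed maximizers have exactly three pendant vertices, the relaxation does not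
change the maximum. -/

section Spectral

/-! ### Quadratic form and Perron vector -/

open SimpleGraph Matrix

/-- Twice the quadratic form of the distance signless Laplacian. -/
noncomputable def distQuadForm {V : Type*} [Fintype V] (G : SimpleGraph V) (x : V → ℝ) : ℝ :=
  ∑ u, ∑ v, (G.dist u v : ℝ) * (x u + x v) ^ 2

lemma two_mul_dotProduct_distSignlessLaplacian_mulVec {V : Type*} [Fintype V] [DecidableEq V]
    (G : SimpleGraph V) (x : V → ℝ) :
    2 * (x ⬝ᵥ (distSignlessLaplacian G *ᵥ x)) = distQuadForm G x := by
  have h1 : distQuadForm G x = ∑ u, ∑ v, (G.dist u v : ℝ) * x u ^ 2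
      + ∑ u, ∑ v, (G.dist u v : ℝ) * x v ^ 2 + 2 * ∑ u, ∑ v, (G.dist u v : ℝ) * (x u * x v) := by
    simp only [distQuadForm, Finset.mul_sum, ← Finset.sum_add_distrib]
    exact Finset.sum_congr rfl fun u _ => Finset.sum_congr rfl fun v _ => by ring
  have h2 : ∑ u, ∑ v, (G.dist u v : ℝ) * x v ^ 2 = ∑ u, ∑ v, (G.dist u v : ℝ) * x u ^ 2 := by
    rw [Finset.sum_comm]
    exact Finset.sum_congr rfl fun u _ => Finset.sum_congr rfl fun v _ => by rw [G.dist_comm]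
  have h3 : x ⬝ᵥ (distSignlessLaplacian G *ᵥ x) = ∑ u, ∑ v, (G.dist u v : ℝ) * x u ^ 2
      + ∑ u, ∑ v, (G.dist u v : ℝ) * (x u * x v) := by
    simp only [distSignlessLaplacian, add_mulVec, dotProduct_add]
    congr 1
    · simp only [dotProduct, mulVec_diagonal, transmission, Finset.sum_mul, Finset.mul_sum]
      exact Finset.sum_congr rfl fun u _ => Finset.sum_congr rfl fun v _ => by ring
    · simp only [dotProduct, mulVec, distanceMatrix, of_apply, Finset.mul_sum]
      exact Finset.sum_congr rfl fun u _ => Finset.sum_congr rfl fun v _ => by ring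
  rw [h1, h2, h3]
  ring

lemma isHermitian_distSignlessLaplacian {V : Type*} [Fintype V] [DecidableEq V]
    (G : SimpleGraph V) : (distSignlessLaplacian G).IsHermitian := by
  refine (isHermitian_diagonal _).add ?_
  ext u v
  simp [distanceMatrix, G.dist_comm]

lemma le_distSignlessLaplacianSpectralRadius {V : Type*} [Fintype V] [DecidableEq V]
    (G : SimpleGraph V) {μ : ℝ}
    (hμ : Module.End.HasEigenvalue (Matrix.toLin' (distSignlessLaplacian G)) μ) :
    μ ≤ distSignlessLaplacianSpectralRadius G :=
  le_csSup (Module.End.finite_hasEigenvalue _).bddAbove hμ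

lemma hasEigenvalue_distSignlessLaplacianSpectralRadius {V : Type*} [Fintype V] [DecidableEq V]
    [Nonempty V] (G : SimpleGraph V) :
    Module.End.HasEigenvalue (Matrix.toLin' (distSignlessLaplacian G))
      (distSignlessLaplacianSpectralRadius G) := by
  have hne : {μ : ℝ | Module.End.HasEigenvalue
      (Matrix.toLin' (distSignlessLaplacian G)) μ}.Nonempty := by
    have hH := isHermitian_distSignlessLaplacian G
    obtain ⟨i⟩ := ‹Nonempty V›
    refine ⟨hH.eigenvalues i, Module.End.hasEigenvalue_of_hasEigenvector
      (x := WithLp.ofLp (hH.eigenvectorBasis i)) ⟨?_, ?_⟩⟩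
    · rw [Module.End.mem_eigenspace_iff, toLin'_apply, hH.mulVec_eigenvectorBasis]
    · intro h
      exact hH.eigenvectorBasis.orthonormal.ne_zero i (by ext j; exact congrFun h j)
  exact hne.csSup_mem (Module.End.finite_hasEigenvalue _)

/-- An eigenvalue `s` of `r • 1 - Q` makes `r - s` an eigenvalue of `Q`, hence at most `r`. -/
lemma posSemidef_spectralRadius_sub_distSignlessLaplacian {V : Type*} [Fintype V] [DecidableEq V]
    (G : SimpleGraph V) :
    (distSignlessLaplacianSpectralRadius G • (1 : Matrix V V ℝ)
      - distSignlessLaplacian G).PosSemidef := by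
  set r := distSignlessLaplacianSpectralRadius G
  have hH : (r • (1 : Matrix V V ℝ) - distSignlessLaplacian G).IsHermitian := by
    refine IsHermitian.sub ?_ (isHermitian_distSignlessLaplacian G)
    simp [IsHermitian]
  rw [hH.posSemidef_iff_eigenvalues_nonneg]
  intro i
  have h1 := hH.mulVec_eigenvectorBasis i
  rw [sub_mulVec, smul_mulVec, one_mulVec, sub_eq_iff_eq_add] at h1
  have : r - hH.eigenvalues i ≤ r := by
    refine le_distSignlessLaplacianSpectralRadius G (Module.End.hasEigenvalue_of_hasEigenvector
      (x := WithLp.ofLp (hH.eigenvectorBasis i)) ⟨?_, ?_⟩)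
    · rw [Module.End.mem_eigenspace_iff, toLin'_apply, sub_smul, h1]
      simp
    · intro h
      exact hH.eigenvectorBasis.orthonormal.ne_zero i (by ext j; exact congrFun h j)
  simpa using this

lemma two_mul_dotProduct_spectralRadius_sub_mulVec {V : Type*} [Fintype V] [DecidableEq V]
    (G : SimpleGraph V) (r : ℝ) (x : V → ℝ) :
    2 * (x ⬝ᵥ ((r • (1 : Matrix V V ℝ) - distSignlessLaplacian G) *ᵥ x)) =
      2 * r * (x ⬝ᵥ x) - distQuadForm G x := by
  rw [← two_mul_dotProduct_distSignlessLaplacian_mulVec, sub_mulVec, smul_mulVec, one_mulVec,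
    dotProduct_sub, dotProduct_smul, smul_eq_mul]
  ring

lemma distQuadForm_le {V : Type*} [Fintype V] [DecidableEq V] (G : SimpleGraph V) (x : V → ℝ) :
    distQuadForm G x ≤ 2 * distSignlessLaplacianSpectralRadius G * (x ⬝ᵥ x) := by
  have h := (posSemidef_spectralRadius_sub_distSignlessLaplacian G).dotProduct_mulVec_nonneg x
  have h2 := two_mul_dotProduct_spectralRadius_sub_mulVec G
    (distSignlessLaplacianSpectralRadius G) x
  simp only [star_trivial] at h
  linarith

/-- The Perron vector of a connected graph. -/
lemma exists_pos_distQuadForm_eq {V : Type*} [Fintype V] [DecidableEq V] [Nontrivial V]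
    {G : SimpleGraph V} (hG : G.Connected) :
    ∃ x : V → ℝ, (∀ v, 0 < x v) ∧
      distQuadForm G x = 2 * distSignlessLaplacianSpectralRadius G * (x ⬝ᵥ x) := by
  set r := distSignlessLaplacianSpectralRadius G with hr
  have hA := posSemidef_spectralRadius_sub_distSignlessLaplacian G
  rw [← hr] at hA
  obtain ⟨z, hz, hz0⟩ := (hasEigenvalue_distSignlessLaplacianSpectralRadius G).exists_hasEigenvector
  rw [Module.End.mem_eigenspace_iff, toLin'_apply, ← hr] at hz
  have hzz : distQuadForm G z = 2 * r * (z ⬝ᵥ z) := by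
    rw [← two_mul_dotProduct_distSignlessLaplacian_mulVec, hz, dotProduct_smul, smul_eq_mul]
    ring
  -- Replacing an eigenvector by its absolute value keeps the norm and does not decrease the form,
  -- so the maximum is still attained.
  set x : V → ℝ := fun v => |z v|
  have hxx : x ⬝ᵥ x = z ⬝ᵥ z := by simp [dotProduct, x]
  have hle : distQuadForm G z ≤ distQuadForm G x := by
    refine Finset.sum_le_sum fun u _ => Finset.sum_le_sum fun v _ =>
      mul_le_mul_of_nonneg_left ?_ (Nat.cast_nonneg _)
    rw [sq_le_sq, abs_of_nonneg (add_nonneg (abs_nonneg (z u)) (abs_nonneg (z v)))]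
    exact abs_add_le _ _
  have hx : distQuadForm G x = 2 * r * (x ⬝ᵥ x) :=
    le_antisymm (distQuadForm_le G x) (by rw [hxx, ← hzz]; exact hle)
  refine ⟨x, fun v => ?_, hx⟩
  -- A positive semidefinite form vanishes only on the kernel.
  have hker : (r • (1 : Matrix V V ℝ) - distSignlessLaplacian G) *ᵥ x = 0 := by
    rw [← hA.dotProduct_mulVec_zero_iff]
    have := two_mul_dotProduct_spectralRadius_sub_mulVec G r x
    simp only [star_trivial]
    linarith
  have heig : r * x v = (distSignlessLaplacian G *ᵥ x) v := by
    have := congrFun hker v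
    rw [sub_mulVec, smul_mulVec, one_mulVec] at this
    simpa [sub_eq_zero] using this
  have hpos : ∀ a b : V, a ≠ b → (0 : ℝ) < G.dist a b := fun a b hab => by
    exact_mod_cast hG.pos_dist_of_ne hab
  -- If `x v = 0`, the eigenvalue equation at `v` reads `0 = ∑ d(v,u) x u`, but the right side is
  -- positive since distances between distinct vertices are.
  refine lt_of_le_of_ne (abs_nonneg (z v)) fun h0 => ?_
  obtain ⟨w, hw⟩ : ∃ w, z w ≠ 0 := Function.ne_iff.mp hz0
  have hvw : v ≠ w := by
    rintro rfl
    exact hw (abs_eq_zero.mp h0.symm)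
  have hsum : (distSignlessLaplacian G *ᵥ x) v = ∑ u, (G.dist v u : ℝ) * x u := by
    rw [distSignlessLaplacian, add_mulVec, Pi.add_apply, mulVec_diagonal]
    rw [show x v = 0 from h0.symm]
    simp [mulVec, dotProduct, distanceMatrix]
  have : (0 : ℝ) < ∑ u, (G.dist v u : ℝ) * x u :=
    Finset.sum_pos' (fun u _ => mul_nonneg (Nat.cast_nonneg _) (abs_nonneg _))
      ⟨w, Finset.mem_univ _, mul_pos (hpos v w hvw) (abs_pos.mpr hw)⟩
  rw [← hsum, ← heig, show x v = 0 from h0.symm, mul_zero] at this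
  exact lt_irrefl _ this

/-- The Perron vector of `G` detects every graph of larger spectral radius. -/
lemma exists_pos_forall_spectralRadius_lt {V : Type*} [Fintype V] [DecidableEq V] [Nontrivial V]
    {G : SimpleGraph V} (hG : G.Connected) :
    ∃ x : V → ℝ, (∀ v, 0 < x v) ∧ ∀ H : SimpleGraph V, distQuadForm G x < distQuadForm H x →
      distSignlessLaplacianSpectralRadius G < distSignlessLaplacianSpectralRadius H := by
  obtain ⟨x, hx, hGx⟩ := exists_pos_distQuadForm_eq hG
  refine ⟨x, hx, fun H hH => ?_⟩
  have h1 := distQuadForm_le H x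
  have h2 : 0 < x ⬝ᵥ x :=
    Finset.sum_pos (fun v _ => mul_pos (hx v) (hx v)) Finset.univ_nonempty
  rw [hGx] at hH
  have := lt_of_mul_lt_mul_right (hH.trans_le h1) h2.le
  linarith

end Spectral

/-! ### Distances in graphs and trees -/

section Graph

open SimpleGraph

lemma mem_pendantVertices {V : Type*} [Fintype V] {G : SimpleGraph V} {v : V} :
    v ∈ pendantVertices G ↔ ∃! w, G.Adj v w := by
  simp [pendantVertices, degree_eq_one_iff_existsUnique_adj]

/-- Pendant vertices stay pendant in connected spanning subgraphs. -/
lemma pendantVertices_subset_of_le {V : Type*} [Fintype V] [Nontrivial V] {G H : SimpleGraph V}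
    (hle : H ≤ G) (hH : H.Connected) : pendantVertices G ⊆ pendantVertices H := by
  intro v hv
  rw [mem_pendantVertices] at hv ⊢
  obtain ⟨w, hw⟩ := hH.preconnected.exists_adj_of_nontrivial v
  exact ⟨w, hw, fun y hy => hv.unique (hle hy) (hle hw)⟩

lemma distQuadForm_lt_of_dist_le {V : Type*} [Fintype V] {G H : SimpleGraph V} {x : V → ℝ}
    (hx : ∀ v, 0 < x v) (hle : ∀ a b, G.dist a b ≤ H.dist a b) {a b : V}
    (hlt : G.dist a b < H.dist a b) : distQuadForm G x < distQuadForm H x := by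
  have hterm : ∀ u v, (G.dist u v : ℝ) * (x u + x v) ^ 2 ≤ (H.dist u v : ℝ) * (x u + x v) ^ 2 :=
    fun u v => mul_le_mul_of_nonneg_right (by exact_mod_cast hle u v) (sq_nonneg _)
  refine Finset.sum_lt_sum (fun u _ => Finset.sum_le_sum fun v _ => hterm u v)
    ⟨a, Finset.mem_univ _, Finset.sum_lt_sum (fun v _ => hterm a v) ⟨b, Finset.mem_univ _, ?_⟩⟩
  exact mul_lt_mul_of_pos_right (by exact_mod_cast hlt) (pow_pos (add_pos (hx a) (hx b)) 2)

lemma distQuadForm_lt_of_lt {V : Type*} [Fintype V] {G H : SimpleGraph V} {x : V → ℝ}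
    (hx : ∀ v, 0 < x v) (hlt : H < G) (hH : H.Connected) :
    distQuadForm G x < distQuadForm H x := by
  obtain ⟨a, b, hab, hnab⟩ : ∃ a b, G.Adj a b ∧ ¬ H.Adj a b := by
    by_contra! h
    exact hlt.not_ge fun a b => h a b
  refine distQuadForm_lt_of_dist_le hx (fun u v => (hH u v).dist_anti hlt.le) (a := a) (b := b) ?_
  rw [dist_eq_one_iff_adj.mpr hab]
  exact hH.one_lt_dist_of_ne_of_not_adj hab.ne hnab

/-- Bounds distances from below without describing geodesics: a guess for the distance need only
grow by at most one along each edge. -/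
lemma le_add_dist_of_forall_adj {V : Type*} {H : SimpleGraph V} (hH : H.Connected) {f : V → ℕ}
    (hf : ∀ y z, H.Adj y z → f z ≤ f y + 1) (y z : V) : f z ≤ f y + H.dist y z := by
  obtain ⟨p, hp⟩ := hH.exists_walk_length_eq_dist y z
  rw [← hp]
  clear hp
  induction p with
  | nil => simp
  | cons h p ih =>
    rw [Walk.length_cons]
    have := hf _ _ h
    lia

/-- In a tree at most one neighbour of `u` is closer to `q` than `u`. -/
lemma two_mul_dist_le_of_adj {V : Type*} {G : SimpleGraph V} (hG : G.IsTree) {u a b : V}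
    (hua : G.Adj u a) (hub : G.Adj u b) (hab : a ≠ b) (q : V) :
    2 * G.dist u q ≤ G.dist a q + G.dist b q := by
  by_cases h : G.dist u q = G.dist a q + 1 ∧ G.dist u q = G.dist b q + 1
  · exfalso
    -- A closer neighbour is the second vertex of a geodesic from `u` to `q`; two such neighbours
    -- would give two paths in a tree.
    have key : ∀ v (hv : G.Adj u v), G.dist u q = G.dist v q + 1 →
        ∃ p : G.Walk u q, p.IsPath ∧ p.snd = v := by
      intro v hv hd
      obtain ⟨p, hp⟩ := hG.connected.exists_walk_length_eq_dist v q
      refine ⟨.cons hv p, Walk.isPath_of_length_eq_dist _ (by rw [Walk.length_cons, hp, hd]),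
        by simp⟩
    obtain ⟨p, hp, rfl⟩ := key a hua h.1
    obtain ⟨p', hp', rfl⟩ := key b hub h.2
    exact hab (by rw [(hG.existsUnique_path u q).unique hp hp'])
  · have h1 := hG.dist_eq_dist_add_one_of_adj q hua
    have h2 := hG.dist_eq_dist_add_one_of_adj q hub
    rw [G.dist_comm (u := q) (v := u), G.dist_comm (u := q)] at h1 h2
    lia

/-! ### Moving a branch to a neighbour -/

/-- The vertices joined to `c` after deletion of the edge between `u` and `c`. -/
def branch {V : Type*} (G : SimpleGraph V) (u c : V) : Set V :=
  {w | (G.deleteEdges {s(u, c)}).Reachable c w}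

/-- The graph in which the branch at `u` through `c` is attached to `a` instead. -/
def moveBranch {V : Type*} (G : SimpleGraph V) (u c a : V) : SimpleGraph V :=
  G.deleteEdges {s(u, c)} ⊔ edge a c

section moveBranch

variable {V : Type*} {G : SimpleGraph V} {u c a : V}

lemma moveBranch_adj (hac : a ≠ c) {x y : V} : (moveBranch G u c a).Adj x y ↔
    (G.Adj x y ∧ s(x, y) ≠ s(u, c)) ∨ s(x, y) = s(a, c) := by
  simp only [moveBranch, sup_adj, deleteEdges_adj, edge_adj, Set.mem_singleton_iff, ne_eq,
    Sym2.eq_iff]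
  refine or_congr Iff.rfl ⟨fun h => h.1, fun h => ⟨h, ?_⟩⟩
  rintro rfl
  rcases h with ⟨rfl, rfl⟩ | ⟨rfl, rfl⟩ <;> exact hac rfl

lemma self_mem_branch : c ∈ branch G u c := Reachable.refl _

lemma notMem_branch (hG : G.IsTree) (hc : G.Adj u c) : u ∉ branch G u c := fun h =>
  isBridge_iff.mp (isAcyclic_iff_forall_adj_isBridge.mp hG.isAcyclic hc) h.symm

lemma mem_branch_iff_of_adj {x y : V} (hxy : G.Adj x y) (hne : s(x, y) ≠ s(u, c)) :
    x ∈ branch G u c ↔ y ∈ branch G u c := by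
  have h : (G.deleteEdges {s(u, c)}).Adj x y := by
    rw [deleteEdges_adj]
    exact ⟨hxy, hne⟩
  exact ⟨fun hx => hx.trans h.reachable, fun hy => hy.trans h.symm.reachable⟩

lemma adj_notMem_branch (hG : G.IsTree) (hc : G.Adj u c) (ha : G.Adj u a) (hac : a ≠ c) :
    a ∉ branch G u c := by
  rw [← mem_branch_iff_of_adj ha fun h => by grind]
  exact notMem_branch hG hc

lemma connected_moveBranch (hG : G.Connected) (ha : G.Adj u a) (hac : a ≠ c) :
    (moveBranch G u c a).Connected := by
  have hcc : (moveBranch G u c a).Reachable c u := by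
    have h1 : (moveBranch G u c a).Adj c a := (moveBranch_adj hac).mpr (Or.inr Sym2.eq_swap)
    have h2 : (moveBranch G u c a).Adj a u :=
      (moveBranch_adj hac).mpr (Or.inl ⟨ha.symm, fun h => by grind⟩)
    exact h1.reachable.trans h2.reachable
  have hadj : ∀ x y, G.Adj x y → (moveBranch G u c a).Reachable x y := by
    intro x y hxy
    by_cases h : s(x, y) = s(u, c)
    · rcases Sym2.eq_iff.mp h with ⟨rfl, rfl⟩ | ⟨rfl, rfl⟩
      exacts [hcc.symm, hcc]
    · exact Adj.reachable ((moveBranch_adj hac).mpr (Or.inl ⟨hxy, h⟩))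
  have := hG.nonempty
  refine ⟨fun x y => ?_⟩
  obtain ⟨p⟩ := hG x y
  induction p with
  | nil => exact Reachable.refl _
  | cons h p ih => exact (hadj _ _ h).trans ih

lemma dist_le_add_one_of_adj (hG : G.Connected) (x : V) {y z : V} (h : G.Adj y z) :
    G.dist x z ≤ G.dist x y + 1 := by
  rw [← dist_eq_one_iff_adj.mpr h]
  exact hG.dist_triangle

-- A path leaving the branch now uses the edge `c a` in place of `c u`, then continues from `a`. The
-- resulting length is the guess `f`, checked on old edges and on the new one.
open Classical in
lemma dist_add_dist_le_dist_moveBranch (hG : G.IsTree) (hc : G.Adj u c) (ha : G.Adj u a)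
    (hac : a ≠ c) {x : V} (hx : x ∈ branch G u c) (y : V) :
    (if y ∈ branch G u c then G.dist x y else G.dist x u + G.dist a y) ≤
      (moveBranch G u c a).dist x y := by
  have h := le_add_dist_of_forall_adj (connected_moveBranch (c := c) hG.connected ha hac)
    (f := fun y => if y ∈ branch G u c then G.dist x y else G.dist x u + G.dist a y) ?_ x y
  · simpa [hx] using h
  · intro y z hyz
    have hcu := dist_le_add_one_of_adj hG.connected x hc
    have huc := dist_le_add_one_of_adj hG.connected x hc.symm
    rcases (moveBranch_adj hac).mp hyz with ⟨hyz, hne⟩ | h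
    · have h1 := dist_le_add_one_of_adj hG.connected x hyz
      have h2 := dist_le_add_one_of_adj hG.connected a hyz
      simp only [mem_branch_iff_of_adj hyz hne]
      split_ifs <;> lia
    · rcases Sym2.eq_iff.mp h with ⟨rfl, rfl⟩ | ⟨rfl, rfl⟩
      · simp only [self_mem_branch, adj_notMem_branch hG hc ha hac, if_true, if_false, dist_self]
        lia
      · simp only [self_mem_branch, adj_notMem_branch hG hc ha hac, if_true, if_false, dist_self]
        lia

open Classical in
lemma dist_le_dist_moveBranch_of_notMem (hG : G.IsTree) (hc : G.Adj u c) (ha : G.Adj u a)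
    (hac : a ≠ c) {x y : V} (hx : x ∉ branch G u c) (hy : y ∉ branch G u c) :
    G.dist x y ≤ (moveBranch G u c a).dist x y := by
  have h := le_add_dist_of_forall_adj (connected_moveBranch (c := c) hG.connected ha hac)
    -- Inside the branch, `d(u,y)` is the length of the new route from `a` to `y` through `c`.
    (f := fun y => if y ∈ branch G u c then G.dist u y + G.dist x a else G.dist x y) ?_ x y
  · simpa [hx, hy] using h
  · intro y z hyz
    have hcu : G.dist u c = 1 := dist_eq_one_iff_adj.mpr hc
    rcases (moveBranch_adj hac).mp hyz with ⟨hyz, hne⟩ | h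
    · have h1 := dist_le_add_one_of_adj hG.connected x hyz
      have h2 := dist_le_add_one_of_adj hG.connected u hyz
      simp only [mem_branch_iff_of_adj hyz hne]
      split_ifs <;> lia
    · rcases Sym2.eq_iff.mp h with ⟨rfl, rfl⟩ | ⟨rfl, rfl⟩
      · simp only [self_mem_branch, adj_notMem_branch hG hc ha hac, if_true, if_false]
        lia
      · simp only [self_mem_branch, adj_notMem_branch hG hc ha hac, if_true, if_false]
        lia

/-- Moving a branch to two different neighbours increases distances on average. -/
lemma two_mul_dist_le_dist_moveBranch_add (hG : G.IsTree) (hc : G.Adj u c) (ha : G.Adj u a)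
    {b : V} (hb : G.Adj u b) (hac : a ≠ c) (hbc : b ≠ c) (hab : a ≠ b) (x y : V) :
    2 * G.dist x y ≤ (moveBranch G u c a).dist x y + (moveBranch G u c b).dist x y := by
  have cross : ∀ x ∈ branch G u c, ∀ y, 2 * G.dist x y ≤
      (moveBranch G u c a).dist x y + (moveBranch G u c b).dist x y := by
    intro x hx y
    have h1 := dist_add_dist_le_dist_moveBranch hG hc ha hac hx y
    have h2 := dist_add_dist_le_dist_moveBranch hG hc hb hbc hx y
    have h3 := two_mul_dist_le_of_adj hG ha hb hab y
    have h4 : G.dist x y ≤ G.dist x u + G.dist u y := hG.connected.dist_triangle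
    split_ifs at h1 h2 <;> lia
  by_cases hx : x ∈ branch G u c
  · exact cross x hx y
  by_cases hy : y ∈ branch G u c
  · have := cross y hy x
    rwa [G.dist_comm, (moveBranch G u c a).dist_comm, (moveBranch G u c b).dist_comm] at this
  · have h1 := dist_le_dist_moveBranch_of_notMem hG hc ha hac hx hy
    have h2 := dist_le_dist_moveBranch_of_notMem hG hc hb hbc hx hy
    lia

/-- Makes the averaged inequality strict: the pair `c`, `u` was at distance one. -/
lemma two_le_dist_moveBranch (hG : G.IsTree) (hc : G.Adj u c) (ha : G.Adj u a) (hac : a ≠ c) :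
    2 ≤ (moveBranch G u c a).dist c u := by
  have h := dist_add_dist_le_dist_moveBranch hG hc ha hac self_mem_branch u
  rwa [if_neg (notMem_branch hG hc), dist_eq_one_iff_adj.mpr hc.symm,
    dist_eq_one_iff_adj.mpr ha.symm] at h

lemma two_mul_distQuadForm_lt [Fintype V] (hG : G.IsTree) (hc : G.Adj u c) (ha : G.Adj u a)
    {b : V} (hb : G.Adj u b) (hac : a ≠ c) (hbc : b ≠ c) (hab : a ≠ b) {x : V → ℝ}
    (hx : ∀ v, 0 < x v) : 2 * distQuadForm G x <
      distQuadForm (moveBranch G u c a) x + distQuadForm (moveBranch G u c b) x := by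
  simp only [distQuadForm, Finset.mul_sum, ← Finset.sum_add_distrib, ← mul_assoc, ← add_mul]
  have hterm : ∀ p q, (2 * (G.dist p q : ℝ)) * (x p + x q) ^ 2 ≤
      ((moveBranch G u c a).dist p q + (moveBranch G u c b).dist p q : ℝ) * (x p + x q) ^ 2 :=
    fun p q => mul_le_mul_of_nonneg_right
      (by exact_mod_cast two_mul_dist_le_dist_moveBranch_add hG hc ha hb hac hbc hab p q)
      (sq_nonneg _)
  refine Finset.sum_lt_sum (fun p _ => Finset.sum_le_sum fun q _ => hterm p q)
    ⟨c, Finset.mem_univ _, Finset.sum_lt_sum (fun q _ => hterm c q) ⟨u, Finset.mem_univ _, ?_⟩⟩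
  refine mul_lt_mul_of_pos_right ?_ (pow_pos (add_pos (hx c) (hx u)) 2)
  have h1 := two_le_dist_moveBranch hG hc ha hac
  have h2 := two_le_dist_moveBranch hG hc hb hbc
  rw [dist_eq_one_iff_adj.mpr hc.symm]
  exact_mod_cast (by lia : 2 * 1 <
    (moveBranch G u c a).dist c u + (moveBranch G u c b).dist c u)

/-- Only `a` gains a neighbour, `c` exchanges `u` for `a`, and `u` was not pendant because it has
two neighbours. -/
lemma pendantVertices_erase_subset_moveBranch [Fintype V] [DecidableEq V]
    (hc : G.Adj u c) (ha : G.Adj u a) {b : V} (hb : G.Adj u b) (hac : a ≠ c) (hab : a ≠ b) :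
    (pendantVertices G).erase a ⊆ pendantVertices (moveBranch G u c a) := by
  intro v hv
  rw [Finset.mem_erase, mem_pendantVertices] at hv
  obtain ⟨hva, w, hw, huniq⟩ := hv
  have hvu : v ≠ u := by
    rintro rfl
    exact hab ((huniq a ha).trans (huniq b hb).symm)
  rw [mem_pendantVertices]
  by_cases hvc : v = c
  · subst hvc
    have hwu : u = w := huniq u hc.symm
    refine ⟨a, (moveBranch_adj hac).mpr (Or.inr Sym2.eq_swap), fun y hy => ?_⟩
    rcases (moveBranch_adj hac).mp hy with ⟨h, hne⟩ | h
    · exact absurd (by rw [huniq y h, hwu, Sym2.eq_swap]) hne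
    · grind
  · refine ⟨w, (moveBranch_adj hac).mpr (Or.inl ⟨hw, by grind⟩), fun y hy => ?_⟩
    rcases (moveBranch_adj hac).mp hy with ⟨h, -⟩ | h
    · exact huniq y h
    · grind

end moveBranch

lemma exists_adj_dist_add_one_eq {V : Type*} {G : SimpleGraph V} (hG : G.Connected) {u v : V}
    (hv : v ≠ u) : ∃ p, G.Adj p v ∧ G.dist u v = G.dist u p + 1 := by
  obtain ⟨w, hw⟩ := hG.exists_walk_length_eq_dist v u
  cases w with
  | nil => exact absurd rfl hv
  | cons h p =>
    rename_i q
    refine ⟨q, h.symm, ?_⟩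
    rw [Walk.length_cons] at hw
    have h1 := dist_le p
    have h2 := dist_le_add_one_of_adj hG u h.symm
    rw [G.dist_comm (u := u) (v := q)] at h2 ⊢
    rw [G.dist_comm (u := u) (v := v)] at h2 ⊢
    lia

/-! ### Brooms -/

/-- A broom with two bristles: a connected graph with a vertex `u` of degree three, two pendant
neighbours of `u`, and all other vertices of degree at most two. -/
structure IsBroom {V : Type*} (G : SimpleGraph V) (u a b c : V) : Prop where
  connected : G.Connected
  hab : a ≠ b
  hac : a ≠ c
  hbc : b ≠ c
  adj_iff : ∀ v, G.Adj u v ↔ v = a ∨ v = b ∨ v = c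
  adj_left : ∀ v, G.Adj b v → v = u
  adj_right : ∀ v, G.Adj c v → v = u
  eq_of_adj : ∀ p, p ≠ u → ∀ x y z, G.Adj p x → G.Adj p y → G.Adj p z → x ≠ z → y ≠ z → x = y

namespace IsBroom

variable {V : Type*} {G : SimpleGraph V} {u a b c : V}

lemma ne_left_right_of_adj (h : IsBroom G u a b c) {p v : V} (hpv : G.Adj p v) (hv : v ≠ u) :
    p ≠ b ∧ p ≠ c := by
  constructor <;> rintro rfl
  exacts [hv (h.adj_left v hpv), hv (h.adj_right v hpv)]

/-- Away from the bristles, distance from `u` is a coordinate. By induction `v` and `w` have the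
same predecessor `p`; if `p = u` only `a` is left, and otherwise `p` also has a predecessor, leaving
room for one further neighbour. -/
lemma eq_of_dist_eq (h : IsBroom G u a b c) : ∀ (i : ℕ) (v w : V), v ≠ b → v ≠ c → w ≠ b → w ≠ c →
    G.dist u v = i → G.dist u w = i → v = w := by
  intro i
  induction i with
  | zero =>
    intro v w _ _ _ _ hv hw
    rw [h.connected.dist_eq_zero_iff] at hv hw
    rw [← hv, ← hw]
  | succ i ih =>
    intro v w hvb hvc hwb hwc hv hw
    have hvu : v ≠ u := by rintro rfl; simp at hv
    have hwu : w ≠ u := by rintro rfl; simp at hw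
    obtain ⟨p, hpv, hp⟩ := exists_adj_dist_add_one_eq h.connected hvu
    obtain ⟨q, hqw, hq⟩ := exists_adj_dist_add_one_eq h.connected hwu
    obtain ⟨hpb, hpc⟩ := h.ne_left_right_of_adj hpv hvu
    obtain ⟨hqb, hqc⟩ := h.ne_left_right_of_adj hqw hwu
    obtain rfl := ih p q hpb hpc hqb hqc (by lia) (by lia)
    by_cases hpu : p = u
    · subst hpu
      have h1 := (h.adj_iff v).mp hpv
      have h2 := (h.adj_iff w).mp hqw
      simp_all
    · obtain ⟨r, hrp, hr⟩ := exists_adj_dist_add_one_eq h.connected hpu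
      refine h.eq_of_adj p hpu v w r hpv hqw hrp.symm ?_ ?_ <;> rintro rfl <;> lia

lemma exists_dist_eq (h : IsBroom G u a b c) : ∀ (i : ℕ) (v : V), v ≠ b → v ≠ c →
    G.dist u v = i → ∀ j ≤ i, ∃ w, w ≠ b ∧ w ≠ c ∧ G.dist u w = j := by
  intro i
  induction i with
  | zero => exact fun v hb hc hv j hj => ⟨v, hb, hc, by lia⟩
  | succ i ih =>
    intro v hb hc hv j hj
    rcases hj.eq_or_lt with rfl | hj
    · exact ⟨v, hb, hc, hv⟩
    · have hvu : v ≠ u := by rintro rfl; simp at hv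
      obtain ⟨p, hpv, hp⟩ := exists_adj_dist_add_one_eq h.connected hvu
      obtain ⟨hpb, hpc⟩ := h.ne_left_right_of_adj hpv hvu
      exact ih p hpb hpc (by lia) j (by lia)

lemma dist_add_three_le_card [Fintype V] (h : IsBroom G u a b c) {v : V} (hvb : v ≠ b)
    (hvc : v ≠ c) : G.dist u v + 3 ≤ Fintype.card V := by
  classical
  -- Each distance from `0` to `d(u,v)` is realized off `b` and `c`, which accounts for the `1 + 2`
  -- in the bound.
  have h1 : Finset.range (G.dist u v + 1) ⊆ ((Finset.univ.erase b).erase c).image (G.dist u) := by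
    intro j hj
    obtain ⟨w, hwb, hwc, hw⟩ := h.exists_dist_eq _ v hvb hvc rfl j (by grind)
    exact Finset.mem_image.mpr ⟨w, by simp [hwb, hwc], hw⟩
  have h2 := (Finset.card_le_card h1).trans Finset.card_image_le
  have h3 : 2 < Fintype.card V := by
    rw [← Finset.card_univ, Finset.two_lt_card]
    exact ⟨a, by simp, b, by simp, c, by simp, h.hab, h.hac, h.hbc⟩
  rw [Finset.card_range, Finset.card_erase_of_mem (by simp [h.hbc.symm]),
    Finset.card_erase_of_mem (by simp), Finset.card_univ] at h2
  lia

lemma adj_iff_dist (h : IsBroom G u a b c) {v w : V} (hvb : v ≠ b) (hvc : v ≠ c) (hwb : w ≠ b)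
    (hwc : w ≠ c) :
    G.Adj v w ↔ G.dist u w = G.dist u v + 1 ∨ G.dist u v = G.dist u w + 1 := by
  have back : ∀ v w, v ≠ b → v ≠ c → G.dist u w = G.dist u v + 1 → G.Adj v w := by
    intro v w hvb hvc hvw
    have hwu : w ≠ u := by rintro rfl; simp at hvw
    obtain ⟨p, hpw, hp⟩ := exists_adj_dist_add_one_eq h.connected hwu
    obtain ⟨hpb, hpc⟩ := h.ne_left_right_of_adj hpw hwu
    rwa [h.eq_of_dist_eq _ v p hvb hvc hpb hpc rfl (by lia)]
  constructor
  · intro hvw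
    have h1 := dist_le_add_one_of_adj h.connected u hvw
    have h2 := dist_le_add_one_of_adj h.connected u hvw.symm
    have h3 : G.dist u v ≠ G.dist u w := fun he =>
      hvw.ne (h.eq_of_dist_eq _ v w hvb hvc hwb hwc rfl he.symm)
    lia
  · rintro (hvw | hvw)
    exacts [back v w hvb hvc hvw, (back w v hwb hwc hvw).symm]

open Classical in
/-- The vertex of `pathWithPendantEdges ℓ 1 2` corresponding to a vertex of a broom. -/
noncomputable def toPath (G : SimpleGraph V) (u b c : V) (ℓ : ℕ) (v : V) :
    Fin ℓ ⊕ (Fin 1 ⊕ Fin 2) :=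
  if v = b then .inr (.inr 0) else if v = c then .inr (.inr 1) else
    if h : G.dist u v < ℓ then .inl ⟨ℓ - 1 - G.dist u v, by lia⟩ else .inr (.inl 0)

/-- The handle is read backwards: `u` is position `ℓ - 1`, and a vertex at distance `ℓ` is the
single pendant vertex attached at `0`. Injectivity and equal cardinalities give a bijection, and
adjacency is determined by distances from `u`. -/
theorem nonempty_iso [Fintype V] (h : IsBroom G u a b c) :
    Nonempty (G ≃g pathWithPendantEdges (Fintype.card V - 3) 1 2) := by
  classical
  have hub := (h.adj_iff b).mpr (by simp)
  have huc := (h.adj_iff c).mpr (by simp)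
  obtain ⟨ℓ, hℓ⟩ : ∃ ℓ, Fintype.card V = ℓ + 3 :=
    ⟨Fintype.card V - 3, by have := h.dist_add_three_le_card hub.ne huc.ne; lia⟩
  rw [hℓ, Nat.add_sub_cancel]
  have hle : ∀ v, v ≠ b → v ≠ c → G.dist u v ≤ ℓ := fun v hb hc => by
    have := h.dist_add_three_le_card hb hc
    lia
  have hpos : 1 ≤ ℓ := by
    rw [← dist_eq_one_iff_adj.mpr ((h.adj_iff a).mpr (by simp))]
    exact hle a h.hab h.hac
  have hinj : Function.Injective (toPath G u b c ℓ) := by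
    intro v w hvw
    have key := h.eq_of_dist_eq (G.dist u v) v w
    have h1 := hle v
    have h2 := hle w
    unfold toPath at hvw
    split_ifs at hvw <;> simp only [reduceCtorEq, Sum.inl.injEq, Sum.inr.injEq, Fin.mk.injEq,
      zero_ne_one, one_ne_zero] at hvw <;> grind
  have hbij : Function.Bijective (toPath G u b c ℓ) := by
    rw [Fintype.bijective_iff_injective_and_card]
    exact ⟨hinj, by simp [hℓ]⟩
  have hzero : ∀ v, G.dist u v = 0 ↔ v = u := fun v => by
    rw [h.connected.dist_eq_zero_iff, eq_comm]
  have hbadj : ∀ v, G.Adj b v ↔ G.dist u v = 0 := fun v => by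
    rw [hzero]
    exact ⟨h.adj_left v, by rintro rfl; exact hub.symm⟩
  have hcadj : ∀ v, G.Adj c v ↔ G.dist u v = 0 := fun v => by
    rw [hzero]
    exact ⟨h.adj_right v, by rintro rfl; exact huc.symm⟩
  have hdb : G.dist u b = 1 := dist_eq_one_iff_adj.mpr hub
  have hdc : G.dist u c = 1 := dist_eq_one_iff_adj.mpr huc
  refine ⟨⟨Equiv.ofBijective _ hbij, ?_⟩⟩
  intro v w
  rw [Equiv.ofBijective_apply, Equiv.ofBijective_apply]
  have hvw := h.adj_iff_dist (v := v) (w := w)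
  have h1 := hle v
  have h2 := hle w
  have hvb := hbadj v
  have hvc := hcadj v
  have hwb := hbadj w
  have hwc := hcadj w
  rw [G.adj_comm] at hvb hvc
  clear hbadj hcadj hbij hinj hle hzero
  unfold toPath
  split_ifs <;> simp only [pathWithPendantEdges, pathGraph_adj] <;> grind

end IsBroom

/-! ### Degree excess in trees -/

-- The degrees sum to `2|V| - 2` by the handshake lemma, while the subtracted terms sum to `2|V|`
-- minus the number of pendant vertices.
open Classical in
lemma sum_degree_sub_eq {V : Type*} [Fintype V] {G : SimpleGraph V} (hG : G.IsTree) :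
    ∑ v, ((G.degree v : ℤ) - if v ∈ pendantVertices G then 1 else 2) =
      (pendantVertices G).card - 2 := by
  have h1 : ∑ v, (G.degree v : ℤ) = 2 * G.edgeFinset.card := by
    exact_mod_cast G.sum_degrees_eq_twice_card_edges
  have h2 := hG.card_edgeFinset
  have h3 : ∑ v, (if v ∈ pendantVertices G then (1 : ℤ) else 2) =
      2 * Fintype.card V - (pendantVertices G).card := by
    have : ∀ v, (if v ∈ pendantVertices G then (1 : ℤ) else 2) =
        2 - if v ∈ pendantVertices G then 1 else 0 := fun v => by split_ifs <;> rfl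
    simp only [this, Finset.sum_sub_distrib]
    simp [mul_comm]
  rw [Finset.sum_sub_distrib, h1, h3]
  lia

open Classical in
lemma le_degree_of_isTree {V : Type*} [Fintype V] [Nontrivial V] {G : SimpleGraph V}
    (hG : G.IsTree) (v : V) :
    0 ≤ (G.degree v : ℤ) - if v ∈ pendantVertices G then 1 else 2 := by
  have h1 := hG.connected.preconnected.degree_pos_of_nontrivial v
  have h2 : v ∈ pendantVertices G ↔ G.degree v = 1 := by simp [pendantVertices]
  split_ifs <;> grind

open Classical in
/-- A tree with at least three pendant vertices has a branching vertex; if there are exactly three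
pendant vertices, it has degree three and is the only one. -/
lemma exists_two_lt_degree {V : Type*} [Fintype V] [Nontrivial V] {G : SimpleGraph V}
    (hG : G.IsTree) (h3 : 3 ≤ (pendantVertices G).card) :
    ∃ u, 2 < G.degree u ∧ ((pendantVertices G).card = 3 →
      G.degree u = 3 ∧ ∀ v ≠ u, G.degree v ≤ 2) := by
  have hsum := sum_degree_sub_eq hG
  have hle := le_degree_of_isTree hG
  have hmem : ∀ v, v ∈ pendantVertices G ↔ G.degree v = 1 := fun v => by simp [pendantVertices]
  set e : V → ℤ := fun v => (G.degree v : ℤ) - if v ∈ pendantVertices G then 1 else 2 with he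
  obtain ⟨u, -, hu⟩ : ∃ u ∈ Finset.univ, 0 < e u :=
    Finset.exists_lt_of_sum_lt (f := fun _ => 0) (by
      simp only [Finset.sum_const_zero]
      lia)
  have hdeg : ∀ v, 0 < e v → (G.degree v : ℤ) = e v + 2 := by
    intro v hv
    have := hmem v
    simp only [he] at hv ⊢
    split_ifs at hv ⊢ <;> grind
  refine ⟨u, by have := hdeg u hu; lia, fun h => ⟨?_, fun v hv => ?_⟩⟩
  -- With three pendant vertices the nonnegative excesses sum to one, so `u` carries all of it.
  · have h1 : e u ≤ ∑ v, e v := Finset.single_le_sum (fun v _ => hle v) (Finset.mem_univ u)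
    have := hdeg u hu
    lia
  · by_contra! hlt
    have h1 : ∑ w ∈ {u, v}, e w ≤ ∑ w, e w :=
      Finset.sum_le_sum_of_subset_of_nonneg (Finset.subset_univ _) fun w _ _ => hle w
    rw [Finset.sum_pair hv.symm] at h1
    have h2 : 0 < e v := by
      simp only [he]
      split_ifs <;> lia
    lia

/-! ### Structure of the maximizers -/

/-- A graph of largest distance signless Laplacian spectral radius among the connected graphs with
at least three pendant vertices. -/
structure IsMaximalWithPendants {V : Type*} [Fintype V] [DecidableEq V] (G : SimpleGraph V) :
    Prop where
  connected : G.Connected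
  three_le : 3 ≤ (pendantVertices G).card
  le : ∀ H : SimpleGraph V, H.Connected → 3 ≤ (pendantVertices H).card →
    distSignlessLaplacianSpectralRadius H ≤ distSignlessLaplacianSpectralRadius G

namespace IsMaximalWithPendants

variable {V : Type*} [Fintype V] [DecidableEq V] {G : SimpleGraph V}

lemma nontrivial (h : IsMaximalWithPendants G) : Nontrivial V := by
  rw [← Fintype.one_lt_card_iff_nontrivial]
  have := (h.three_le).trans (Finset.card_le_univ _)
  lia

/-- A proper connected spanning subgraph has larger distances and keeps every pendant vertex. It may
gain new ones, which is why the class asks for at least three. -/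
lemma isTree (h : IsMaximalWithPendants G) : G.IsTree := by
  have := h.nontrivial
  obtain ⟨T, hTG, hT⟩ := h.connected.exists_isTree_le
  rcases hTG.eq_or_lt with rfl | hlt
  · exact hT
  · obtain ⟨x, hx, hG⟩ := exists_pos_forall_spectralRadius_lt h.connected
    have h1 := hG T (distQuadForm_lt_of_lt hx hlt hT.connected)
    have h2 := h.le T hT.connected
      (h.three_le.trans (Finset.card_le_card (pendantVertices_subset_of_le hTG hT.connected)))
    exact absurd h1 h2.not_gt

/-- Otherwise both moves of the branch through `c` stay in the class, and by averaging one of them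
has a larger radius. -/
lemma card_erase_lt_three (h : IsMaximalWithPendants G) {u a b c : V} (ha : G.Adj u a)
    (hb : G.Adj u b) (hc : G.Adj u c) (hab : a ≠ b) (hac : a ≠ c) (hbc : b ≠ c) :
    ((pendantVertices G).erase a).card < 3 ∨ ((pendantVertices G).erase b).card < 3 := by
  by_contra! hcard
  have := h.nontrivial
  obtain ⟨x, hx, hG⟩ := exists_pos_forall_spectralRadius_lt h.connected
  have hlt := two_mul_distQuadForm_lt h.isTree hc ha hb hac hbc hab hx
  have key : ∀ {a b : V}, G.Adj u a → G.Adj u b → a ≠ b → a ≠ c →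
      3 ≤ ((pendantVertices G).erase a).card →
      ¬ distQuadForm G x < distQuadForm (moveBranch G u c a) x := by
    intro a b ha hb hab hac hcard hlt
    exact (hG _ hlt).not_ge (h.le _ (connected_moveBranch h.connected ha hac)
      (hcard.trans (Finset.card_le_card
        (pendantVertices_erase_subset_moveBranch hc ha hb hac hab))))
  have h1 := key ha hb hab hac hcard.1
  have h2 := key hb ha hab.symm hbc hcard.2
  linarith

open Classical in
lemma exists_isBroom (h : IsMaximalWithPendants G) :
    (pendantVertices G).card = 3 ∧ ∃ u a b c, IsBroom G u a b c := by
  have := h.nontrivial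
  obtain ⟨u, hu, hdeg⟩ := exists_two_lt_degree h.isTree h.three_le
  have hcard : (pendantVertices G).card = 3 := by
    rw [← G.card_neighborFinset_eq_degree, Finset.two_lt_card] at hu
    obtain ⟨a, ha, b, hb, c, hc, hab, hac, hbc⟩ := hu
    rw [mem_neighborFinset] at ha hb hc
    have h1 := h.card_erase_lt_three ha hb hc hab hac hbc
    have h2 := h.three_le
    have h3 : ∀ v, (pendantVertices G).card - 1 ≤ ((pendantVertices G).erase v).card :=
      fun v => Finset.pred_card_le_card_erase
    have := h3 a
    have := h3 b
    lia
  refine ⟨hcard, ?_⟩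
  obtain ⟨hdu, hdv⟩ := hdeg hcard
  rw [← G.card_neighborFinset_eq_degree, Finset.card_eq_three] at hdu
  obtain ⟨a, b, c, hab, hac, hbc, hN⟩ := hdu
  have hadj : ∀ v, G.Adj u v ↔ v = a ∨ v = b ∨ v = c := fun v => by
    rw [← mem_neighborFinset, hN]
    simp
  have hua := (hadj a).mpr (by simp)
  have hub := (hadj b).mpr (by simp)
  have huc := (hadj c).mpr (by simp)
  -- With exactly three pendant vertices, erasing a non-pendant one loses nothing, so any two of the
  -- three neighbours include a pendant vertex; hence at least two are pendant.
  have hone : ∀ {a b c : V}, G.Adj u a → G.Adj u b → G.Adj u c → a ≠ b → a ≠ c → b ≠ c →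
      a ∈ pendantVertices G ∨ b ∈ pendantVertices G := by
    intro a b c ha hb hc hab hac hbc
    by_contra! hP
    have := h.card_erase_lt_three ha hb hc hab hac hbc
    rw [Finset.erase_eq_of_notMem hP.1, Finset.erase_eq_of_notMem hP.2] at this
    lia
  have hbroom : ∀ {a b c : V}, a ≠ b → a ≠ c → b ≠ c →
      (∀ v, G.Adj u v ↔ v = a ∨ v = b ∨ v = c) → b ∈ pendantVertices G →
      c ∈ pendantVertices G → IsBroom G u a b c := by
    intro a b c hab hac hbc hadj hb hc
    rw [mem_pendantVertices] at hb hc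
    refine ⟨h.connected, hab, hac, hbc, hadj,
      fun v hv => hb.unique hv ((hadj b).mpr (by simp)).symm,
      fun v hv => hc.unique hv ((hadj c).mpr (by simp)).symm,
      fun p hp x y z hx hy hz hxz hyz => ?_⟩
    by_contra hxy
    have h1 : 2 < (G.neighborFinset p).card := by
      rw [Finset.two_lt_card]
      exact ⟨x, by simpa using hx, y, by simpa using hy, z, by simpa using hz, hxy, hxz, hyz⟩
    rw [G.card_neighborFinset_eq_degree] at h1
    exact (hdv p hp).not_gt h1
  have h1 := hone hua hub huc hab hac hbc
  have h2 := hone hua huc hub hac hab hbc.symm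
  have h3 := hone hub huc hua hbc hab.symm hac.symm
  by_cases hb : b ∈ pendantVertices G
  · by_cases hc : c ∈ pendantVertices G
    · exact ⟨u, a, b, c, hbroom hab hac hbc hadj hb hc⟩
    · exact ⟨u, c, a, b, hbroom hac.symm hbc.symm hab (fun v => by rw [hadj]; tauto)
        (h2.resolve_right hc) hb⟩
  · exact ⟨u, b, a, c, hbroom hab.symm hbc hac (fun v => by rw [hadj]; tauto)
      (h1.resolve_right hb) (h3.resolve_left hb)⟩

end IsMaximalWithPendants

end Graph

theorem theorem3p6 (n : ℕ) (G : SimpleGraph (Fin n))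
    (hG : G ∈ connectedGraphsWithPendants n 3)
    (hmax : ∀ H ∈ connectedGraphsWithPendants n 3,
      distSignlessLaplacianSpectralRadius H ≤ distSignlessLaplacianSpectralRadius G) :
    Nonempty (G ≃g pathWithPendantEdges (n - 3) 1 2) := by
  obtain ⟨M, ⟨hM, hM3⟩, hMle⟩ := Set.exists_max_image
    {H : SimpleGraph (Fin n) | H.Connected ∧ 3 ≤ (pendantVertices H).card}
    distSignlessLaplacianSpectralRadius (Set.toFinite _) ⟨G, hG.1, hG.2.ge⟩
  have hMmax : IsMaximalWithPendants M := ⟨hM, hM3, fun H h1 h2 => hMle H ⟨h1, h2⟩⟩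
  -- The relaxed maximizer `M` has exactly three pendant vertices, so `hmax` applies to it and `G`
  -- is a relaxed maximizer too.
  have hGmax : IsMaximalWithPendants G := ⟨hG.1, hG.2.ge, fun H h1 h2 =>
    (hMmax.le H h1 h2).trans (hmax M ⟨hM, hMmax.exists_isBroom.1⟩)⟩
  obtain ⟨u, a, b, c, h⟩ := hGmax.exists_isBroom.2
  have hiso := h.nonempty_iso
  rwa [Fintype.card_fin] at hiso
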